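/- Let $A$ be an ordered Banach algebra, i.e. a complex Banach algebra with unit $\mathbf e\neq 0$, ordered by a closed convex pointed cone $A^+$ with $\mathbf e\in A^+$ and $A^+A^+\subseteq A^+$. Let $\mathbf{OI}(A)=\{p\in A: 0\le p\le \mathbf e,\ p^2=p\}$ be the Boolean algebra of order idempotents, and write $p^{\rm d}=\mathbf e-p$. Let $A_{\rm n}$ be the set of order continuous elements: those $a\ge 0$ such that $p_\alpha a\downarrow 0$ and $ap_\alpha\downarrow 0$ in $A$ for every net $p_\alpha\downarrow 0$ in $\mathbf{OI}(A)$. Assume Axiom (A$_1$): $A$ is order regular ($ab\in A_{\rm n}$ for all $a,b\in A_{\rm n}$); $A$ has a disjunctive product (if $a,b\in A_{\rm n}$ and $ab=0$, then $ap=p^{\rm d}b=0$ for some $p\in\mathbf{OI}(A)$); $\mathbf{OI}(A)$ is Dedekind complete; and $A_{\rm n}$ is closed in $A$. Let $a\in A_{\rm n}$ have the Frobenius normal form: there are $p_0,\dots,p_n\in\mathbf{OI}(A)$ with $0=p_0\le p_1\le\dots\le p_n=\mathbf e$ and $p_i^{\rm d}ap_i=0$ for all $i$ such that, with $q_i=p_ip_{i-1}^{\rm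 d}$ for $i=1,\dots,n$, whenever the spectral radius satisfies $r(q_iaq_i)=r(a)$, the element $b=q_iaq_i$ is irreducible with respect to $q_i$, i.e. there is no $q\in\mathbf{OI}(A)$ with $0<q<q_i$ and $(q_i-q)bq=0$. Suppose that $r(a)$ is a pole (of some order $k\ge1$) of the resolvent $R(\lambda,a)=(\lambda-a)^{-1}$, and let $a_{-1}$ be the residue of $R(\cdot,a)$ at $r(a)$, i.e. the coefficient of $(\lambda-r(a))^{-1}$ in its Laurent expansion around $r(a)$. Call $b\in A$ relatively algebraically strictly positive if there is a non-zero $q\in\mathbf{OI}(A)$ with $qbq=b$ and $q_1bq_2>0$ for all $q_1,q_2\in\mathbf{OI}(A)$ with $0<q_1,q_2\le q$. Let $\mathcal F(A)$, the set of finite-rank elements, be the two-sided algebraic ideal of $A$ generated by all relatively algebraically strictly positive idempotents in $A_{\rm n}$, with $\mathcal F(A)=\emptyset$ if there are no such idempotents. Then $a_{-1}\in\mathcal F(A)$. -/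

import Mathlib

open Filter Topology

universe u

namespace OrderedBanachAlg

section Order

variable {A : Type u} [Ring A] [PartialOrder A]

/-- The order idempotents of `A`: `0 ≤ p ≤ 1` and `p * p = p`. -/
def OI (A : Type u) [Ring A] [PartialOrder A] : Set A :=
  {p | 0 ≤ p ∧ p ≤ 1 ∧ p * p = p}

/-- The net `x` decreases to `z`, i.e. `x ↓ z` in the ordered set `P`. -/
def DecreasesTo {P : Type*} [Preorder P] {ι : Type*} [Preorder ι] (x : ι → P) (z : P) : Prop :=
  Antitone x ∧ IsGLB (Set.range x) z

/-- The set `A_n` of order continuous elements: positive `a` such that `p_α a ↓ 0` and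
`a p_α ↓ 0` in `A` for every net `p_α ↓ 0` in `OI A`. The infimum of `p_α` is taken in `OI A`,
the infima of `p_α a` and `a p_α` are taken in `A`. (Whether `x ↓ z` depends, for a decreasing
net, only on its range, so index sets in the universe of `A` are all that is needed.) -/
def orderContinuous (A : Type u) [Ring A] [PartialOrder A] : Set A :=
  {a | 0 ≤ a ∧ ∀ (ι : Type u) [Preorder ι] [IsDirectedOrder ι] [Nonempty ι] (p : ι → OI A)
      (z : OI A), (z : A) = 0 → DecreasesTo p z →
      DecreasesTo (fun α => (p α : A) * a) 0 ∧ DecreasesTo (fun α => a * (p α : A)) 0}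

/-- `A` is order regular: `A_n` is a multiplicative subsemigroup of `A`. -/
def OrderRegular (A : Type u) [Ring A] [PartialOrder A] : Prop :=
  ∀ a ∈ orderContinuous A, ∀ b ∈ orderContinuous A, a * b ∈ orderContinuous A

/-- `A` has a disjunctive product. -/
def DisjunctiveProduct (A : Type u) [Ring A] [PartialOrder A] : Prop :=
  ∀ a ∈ orderContinuous A, ∀ b ∈ orderContinuous A, a * b = 0 →
    ∃ p ∈ OI A, a * p = 0 ∧ (1 - p) * b = 0

/-- The Boolean algebra `OI A` is Dedekind complete. -/
def DedekindCompleteOI (A : Type u) [Ring A] [PartialOrder A] : Prop :=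
  ∀ S : Set (OI A), S.Nonempty → BddAbove S → ∃ p : OI A, IsLUB S p

/-- Axiom (A₁). -/
structure AxiomA1 (A : Type u) [Ring A] [PartialOrder A] [TopologicalSpace A] : Prop where
  orderRegular : OrderRegular A
  disjunctive : DisjunctiveProduct A
  dedekind : DedekindCompleteOI A
  closed : IsClosed (orderContinuous A)

/-- The order idempotent `p` is `a`-invariant: `(1 - p) a p = 0`. -/
def IsInvariant (a p : A) : Prop :=
  (1 - p) * a * p = 0

/-- `a` is irreducible with respect to the order idempotent `p`: no order idempotent `q` with
`0 < q < p` satisfies `(p - q) a q = 0`. -/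
def IrreducibleWrt (a p : A) : Prop :=
  ¬ ∃ q ∈ OI A, 0 < q ∧ q < p ∧ (p - q) * a * q = 0

/-- `b` is relatively algebraically strictly positive: for some nonzero order idempotent `q`,
`b` belongs to `A(q) = {x | q x q = x}` and `q₁ b q₂ > 0` for all order idempotents `q₁, q₂`
with `0 < q₁, q₂ ≤ q`. -/
def RelStrictlyPositive (b : A) : Prop :=
  ∃ q ∈ OI A, q ≠ 0 ∧ q * b * q = b ∧
    ∀ q₁ ∈ OI A, ∀ q₂ ∈ OI A, 0 < q₁ → q₁ ≤ q → 0 < q₂ → q₂ ≤ q → 0 < q₁ * b * q₂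

/-- The relatively algebraically strictly positive order continuous projections of `A`. -/
def rankOneProjections (A : Type u) [Ring A] [PartialOrder A] : Set A :=
  {b | b * b = b ∧ b ∈ orderContinuous A ∧ RelStrictlyPositive b}

/-- The set `F(A)` of finite-rank elements: the two-sided algebraic ideal generated by the
relatively algebraically strictly positive order continuous projections, and the empty set if
there are no such projections. (`A` has a unit, so ring ideals are linear subspaces.) -/
def finiteRank (A : Type u) [Ring A] [PartialOrder A] : Set A :=
  {x | (rankOneProjections A).Nonempty ∧ x ∈ TwoSidedIdeal.span (rankOneProjections A)}

end Order

section Spectral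

variable {A : Type u} [NormedRing A] [NormedAlgebra ℂ A]

/-- The element `a` has the Frobenius normal form: there are `a`-invariant order idempotents
`0 = p₀ ≤ p₁ ≤ … ≤ pₙ = 1` such that, with `qᵢ = pᵢ (1 - pᵢ₋₁)`, the block `qᵢ a qᵢ` is irreducible
with respect to `qᵢ` whenever its spectral radius is that of `a`. -/
def HasFrobeniusNormalForm [PartialOrder A] (a : A) : Prop :=
  ∃ (n : ℕ) (p : Fin (n + 1) → A),
    (∀ i, p i ∈ OI A ∧ IsInvariant a (p i)) ∧
    p 0 = 0 ∧ p (Fin.last n) = 1 ∧ (∀ i : Fin n, p i.castSucc ≤ p i.succ) ∧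
    ∀ (i : Fin n) (q : A), q = p i.succ * (1 - p i.castSucc) →
      spectralRadius ℂ (q * a * q) = spectralRadius ℂ a → IrreducibleWrt (q * a * q) q

/-- `f z = ∑_{j ∈ ℤ} (z - z₀)^j c_j` in a punctured neighbourhood of `z₀`. The Laurent coefficients
`c` are uniquely determined by `f` and `z₀`, and `c (-1)` is the residue. -/
def IsLaurentExpansionAt (f : ℂ → A) (z₀ : ℂ) (c : ℤ → A) : Prop :=
  ∀ᶠ z in 𝓝[≠] z₀, HasSum (fun j : ℤ => (z - z₀) ^ j • c j) (f z)

/-- The point `z₀` is a pole of order `k ≥ 1` of the resolvent `R(·, b)`, and `c` is the family of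
its Laurent coefficients around `z₀`: `z₀` is an isolated point of the spectrum of `b`,
`c j = 0` for `j < -k`, and `c (-k) ≠ 0`. -/
structure IsResolventPole (b : A) (z₀ : ℂ) (k : ℕ) (c : ℤ → A) : Prop where
  one_le : 1 ≤ k
  mem_spectrum : z₀ ∈ spectrum ℂ b
  isolated : ∀ᶠ z in 𝓝[≠] z₀, z ∉ spectrum ℂ b
  laurent : IsLaurentExpansionAt (resolvent b) z₀ c
  eq_zero : ∀ j : ℤ, j < -(k : ℤ) → c j = 0
  ne_zero : c (-(k : ℤ)) ≠ 0

/-- The spectral radius `r(a)` as a real number (it is finite in a Banach algebra). -/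
noncomputable def specRadius (a : A) : ℝ :=
  (spectralRadius ℂ a).toReal

end Spectral

end OrderedBanachAlg

namespace OrderedBanachAlg

/-! ### Order idempotents and order continuous elements. -/

section Order

variable {A : Type u} [Ring A] [PartialOrder A]

/-! Write `r = r(a)` and `P = a₋₁`. The recursion between Laurent coefficients makes `P` a nonzero
idempotent, and the Neumann series makes it block triangular along the chain `pᵢ`. By
`mem_of_blocks_mem` such an idempotent lies in any ideal that contains its diagonal blocks, so it
suffices to treat each `qPq`.

Let `r > 0`, `qPq ≠ 0`, and let `m ≤ -1` be the least index with `x = q c_m q ≠ 0`. Minimality gives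
`bx = xb = rx` for `b = qaq`, so `r(b) = r(a)` and `b` is irreducible; `x` is order continuous
because `A_n` is closed. By the disjunctive product and Dedekind completeness, annihilators of
eigenvectors of `b` are trivial below `q` (`right_faithful`, `left_faithful`). Hence `x` is strictly
positive on `q` and `x² ≠ 0`. But `x² = q c_{2m+1} q` vanishes when `m < -1`, so `m = -1` and `qPq =
x` is one of the generating projections (`block_residue_mem`).

If `r = 0`, then `a` is nilpotent, so every block is irreducible and nilpotent, hence zero. Each
nonzero `q` is then an atom and itself a generator, and the ideal contains `1`. -/

theorem zero_mem_OI [ZeroLEOneClass A] : (0 : A) ∈ OI A :=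
  ⟨le_rfl, zero_le_one, mul_zero 0⟩

variable [IsOrderedRing A]

theorem one_sub_mem_OI {p : A} (hp : p ∈ OI A) : 1 - p ∈ OI A := by
  obtain ⟨h0, h1, hpp⟩ := hp
  refine ⟨sub_nonneg.2 h1, sub_le_self _ h0, ?_⟩
  rw [mul_sub, sub_mul, sub_mul, hpp]; simp

/-- Since `0 ≤ q ≤ 1`, the products `(1 - p) q p` and `p q (1 - p)` are squeezed between `0` and
`0`, so `qp = pqp = pq`. -/
theorem OI_mul_comm {p q : A} (hp : p ∈ OI A) (hq : q ∈ OI A) : p * q = q * p := by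
  obtain ⟨hp0, hp1, hpp⟩ := hp
  obtain ⟨hq0, hq1, -⟩ := hq
  have hd : 0 ≤ 1 - p := sub_nonneg.2 hp1
  have e1 : (1 - p) * q * p = 0 := by
    apply le_antisymm
    · calc (1 - p) * q * p ≤ (1 - p) * 1 * p :=
            mul_le_mul_of_nonneg_right (mul_le_mul_of_nonneg_left hq1 hd) hp0
        _ = 0 := by rw [mul_one, sub_mul, hpp, one_mul, sub_self]
    · exact mul_nonneg (mul_nonneg hd hq0) hp0
  have e2 : p * q * (1 - p) = 0 := by
    apply le_antisymm
    · calc p * q * (1 - p) ≤ p * 1 * (1 - p) :=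
            mul_le_mul_of_nonneg_right (mul_le_mul_of_nonneg_left hq1 hp0) hd
        _ = 0 := by rw [mul_one, mul_sub, hpp, mul_one, sub_self]
    · exact mul_nonneg (mul_nonneg hp0 hq0) hd
  have e1' : q * p = p * q * p := by
    rw [sub_mul, sub_mul, one_mul] at e1; exact sub_eq_zero.1 e1
  have e2' : p * q = p * q * p := by
    rw [mul_sub, mul_one] at e2; exact sub_eq_zero.1 e2
  rw [e2', ← e1']

theorem OI_mul_mem {p q : A} (hp : p ∈ OI A) (hq : q ∈ OI A) : p * q ∈ OI A := by
  refine ⟨mul_nonneg hp.1 hq.1, mul_le_one₀ hp.2.1 hq.1 hq.2.1, ?_⟩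
  rw [mul_assoc, ← mul_assoc q, OI_mul_comm hq hp, mul_assoc, hq.2.2, ← mul_assoc, hp.2.2]

theorem OI_mul_eq_of_le {p q : A} (hp : p ∈ OI A) (hq : q ∈ OI A) (h : p ≤ q) : p * q = p := by
  apply le_antisymm
  · simpa using mul_le_mul_of_nonneg_left hq.2.1 hp.1
  · simpa [hp.2.2] using mul_le_mul_of_nonneg_left h hp.1

theorem OI_mul_eq_of_le' {p q : A} (hp : p ∈ OI A) (hq : q ∈ OI A) (h : p ≤ q) : q * p = p := by
  rw [OI_mul_comm hq hp, OI_mul_eq_of_le hp hq h]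

theorem OI_sub_mem {p q : A} (hp : p ∈ OI A) (hq : q ∈ OI A) (h : p ≤ q) : q - p ∈ OI A := by
  have := OI_mul_mem hq (one_sub_mem_OI hp)
  rwa [mul_sub, mul_one, OI_mul_eq_of_le' hp hq h] at this

theorem OI_mul_le_left {p q : A} (hp : p ∈ OI A) (hq : q ∈ OI A) : p * q ≤ p := by
  simpa using mul_le_mul_of_nonneg_left hq.2.1 hp.1

theorem OI_mul_le_right {p q : A} (hp : p ∈ OI A) (hq : q ∈ OI A) : p * q ≤ q := by
  simpa using mul_le_mul_of_nonneg_right hp.2.1 hq.1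

theorem OI_add_sub_mul_mem {p q : A} (hp : p ∈ OI A) (hq : q ∈ OI A) :
    p + q - p * q ∈ OI A := by
  have := one_sub_mem_OI (OI_mul_mem (one_sub_mem_OI hp) (one_sub_mem_OI hq))
  convert this using 1
  noncomm_ring

/-- A lower bound of the `p_α b` is also one of the `p_α a`, so the infimum is squeezed; the same
holds on the other side. -/
theorem orderContinuous_of_le {a b : A} (ha : a ∈ orderContinuous A) (hb : 0 ≤ b) (h : b ≤ a) :
    b ∈ orderContinuous A := by
  refine ⟨hb, fun ι _ _ _ p z hz hp => ?_⟩
  obtain ⟨⟨_, h1⟩, _, h2⟩ := ha.2 ι p z hz hp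
  refine ⟨⟨fun i j hij => mul_le_mul_of_nonneg_right (hp.1 hij) hb, ?_, fun w hw => h1.2 ?_⟩,
    ⟨fun i j hij => mul_le_mul_of_nonneg_left (hp.1 hij) hb, ?_, fun w hw => h2.2 ?_⟩⟩
  · rintro _ ⟨i, rfl⟩; exact mul_nonneg (p i).2.1 hb
  · rintro _ ⟨i, rfl⟩
    exact (hw ⟨i, rfl⟩).trans (mul_le_mul_of_nonneg_left h (p i).2.1)
  · rintro _ ⟨i, rfl⟩; exact mul_nonneg hb (p i).2.1
  · rintro _ ⟨i, rfl⟩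
    exact (hw ⟨i, rfl⟩).trans (mul_le_mul_of_nonneg_right h (p i).2.1)

theorem orderContinuous_mul_left {a p : A} (ha : a ∈ orderContinuous A) (hp : p ∈ OI A) :
    p * a ∈ orderContinuous A :=
  orderContinuous_of_le ha (mul_nonneg hp.1 ha.1)
    (by simpa using mul_le_mul_of_nonneg_right hp.2.1 ha.1)

theorem orderContinuous_mul_right {a p : A} (ha : a ∈ orderContinuous A) (hp : p ∈ OI A) :
    a * p ∈ orderContinuous A :=
  orderContinuous_of_le ha (mul_nonneg ha.1 hp.1)
    (by simpa using mul_le_mul_of_nonneg_left hp.2.1 ha.1)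

omit [IsOrderedRing A] in
theorem zero_mem_orderContinuous : (0 : A) ∈ orderContinuous A := by
  refine ⟨le_rfl, fun ι _ _ _ p z hz hp => ?_⟩
  simp only [mul_zero, zero_mul, Set.range_const, DecreasesTo]
  exact ⟨⟨antitone_const, isGLB_singleton⟩, antitone_const, isGLB_singleton⟩

/-- The sum of two nets decreasing to zero decreases to zero. -/
theorem DecreasesTo.add_zero {ι : Type*} [Preorder ι] [IsDirectedOrder ι] {x y : ι → A}
    (hx : DecreasesTo x 0) (hy : DecreasesTo y 0) : DecreasesTo (fun i => x i + y i) 0 := by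
  refine ⟨fun i j hij => add_le_add (hx.1 hij) (hy.1 hij), ?_, fun w hw => ?_⟩
  · rintro _ ⟨i, rfl⟩
    exact add_nonneg (hx.2.1 ⟨i, rfl⟩) (hy.2.1 ⟨i, rfl⟩)
  -- With `j` fixed, directedness gives `w - y j ≤ x i` for every `i`, hence `w ≤ y j`.
  · apply hy.2.2
    rintro _ ⟨j, rfl⟩
    rw [← sub_nonpos]
    apply hx.2.2
    rintro _ ⟨i, rfl⟩
    obtain ⟨l, hi, hj⟩ := exists_ge_ge i j
    rw [sub_le_iff_le_add]
    exact (hw ⟨l, rfl⟩).trans (add_le_add (hx.1 hi) (hy.1 hj))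

theorem orderContinuous_add {a b : A} (ha : a ∈ orderContinuous A) (hb : b ∈ orderContinuous A) :
    a + b ∈ orderContinuous A := by
  refine ⟨add_nonneg ha.1 hb.1, fun ι _ _ _ p z hz hp => ?_⟩
  simp only [mul_add, add_mul]
  exact ⟨(ha.2 ι p z hz hp).1.add_zero (hb.2 ι p z hz hp).1,
    (ha.2 ι p z hz hp).2.add_zero (hb.2 ι p z hz hp).2⟩

theorem orderContinuous_sum {ι : Type*} (s : Finset ι) {f : ι → A}
    (hf : ∀ i ∈ s, f i ∈ orderContinuous A) : ∑ i ∈ s, f i ∈ orderContinuous A :=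
  Finset.sum_induction f (· ∈ orderContinuous A) (fun _ _ => orderContinuous_add)
    zero_mem_orderContinuous hf

omit [IsOrderedRing A] in
theorem orderContinuous_pow (hA : OrderRegular A) {a : A} (ha : a ∈ orderContinuous A) (n : ℕ) :
    a ^ (n + 1) ∈ orderContinuous A := by
  induction n with
  | zero => simpa using ha
  | succ n ih => rw [pow_succ]; exact hA _ ih _ ha

/-- The supremum of a directed set of order idempotents is approximated from below by a net
whose differences to the supremum decrease to zero. -/
theorem decreasesTo_sub_isLUB (S : Set (OI A)) (hS : S.Nonempty) (p₀ : OI A) (h : IsLUB S p₀) :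
    DecreasesTo (fun p : S => (⟨p₀ - p.1, OI_sub_mem p.1.2 p₀.2 (h.1 p.2)⟩ : OI A))
      ⟨0, zero_mem_OI⟩ := by
  refine ⟨fun p q hpq => ?_, ?_, fun w hw => ?_⟩
  · have : (p.1 : A) ≤ q.1 := hpq
    exact sub_le_sub_left this (p₀ : A)
  · rintro _ ⟨p, rfl⟩
    have : (p.1 : A) ≤ p₀ := h.1 p.2
    exact sub_nonneg.2 this
  · have hw' : ∀ p ∈ S, (w : A) ≤ p₀ - p := fun p hp => hw ⟨⟨p, hp⟩, rfl⟩
    obtain ⟨p, hp⟩ := hS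
    have hle : (w : A) ≤ p₀ := (hw' p hp).trans (sub_le_self _ p.2.1)
    have : p₀ ≤ (⟨p₀ - w, OI_sub_mem w.2 p₀.2 hle⟩ : OI A) := by
      apply h.2
      intro p hp
      exact le_sub_comm.1 (hw' p hp)
    have h3 : (p₀ : A) ≤ p₀ - w := this
    have h4 : (w : A) ≤ 0 := by simpa using h3
    exact h4

/-! ### Annihilators and irreducibility. -/

/-- Among the order idempotents `p ≤ q` with `y * p = 0` there is a largest one. -/
theorem exists_greatest_right_annihilator (hD : DedekindCompleteOI A) {y q : A}
    (hy : y ∈ orderContinuous A) (hq : q ∈ OI A) :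
    ∃ p₀ ∈ OI A, p₀ ≤ q ∧ y * p₀ = 0 ∧ ∀ p ∈ OI A, p ≤ q → y * p = 0 → p ≤ p₀ := by
  set S : Set (OI A) := {p | (p : A) ≤ q ∧ y * p = 0} with hSdef
  have hne : S.Nonempty := ⟨⟨0, zero_mem_OI⟩, hq.1, mul_zero y⟩
  obtain ⟨p₀, hp₀⟩ := hD S hne ⟨⟨q, hq⟩, fun p hp => hp.1⟩
  have hle : (p₀ : A) ≤ q := hp₀.2 (show (⟨q, hq⟩ : OI A) ∈ upperBounds S from fun p hp => hp.1)
  have hne' : Nonempty S := hne.to_subtype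
  have hdir : IsDirectedOrder S := ⟨by
    rintro ⟨p, hp⟩ ⟨p', hp'⟩
    have hmem := OI_add_sub_mul_mem p.2 p'.2
    refine ⟨⟨⟨_, hmem⟩, ?_, ?_⟩, ?_, ?_⟩
    · have e : q * ((p : A) + p' - p * p') = p + p' - p * p' := by
        rw [mul_sub, mul_add, ← mul_assoc, OI_mul_eq_of_le' p.2 hq hp.1,
          OI_mul_eq_of_le' p'.2 hq hp'.1]
      change ((p : A) + p' - p * p') ≤ q
      rw [← e]
      exact OI_mul_le_left hq hmem
    · change y * ((p : A) + p' - p * p') = 0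
      rw [mul_sub, mul_add, ← mul_assoc, hp.2, hp'.2]; simp
    · change (p : A) ≤ p + p' - p * p'
      have := OI_mul_le_right p.2 p'.2
      rw [add_sub_assoc]
      exact le_add_of_nonneg_right (sub_nonneg.2 this)
    · change (p' : A) ≤ p + p' - p * p'
      have := OI_mul_le_left p.2 p'.2
      rw [add_sub_right_comm]
      exact le_add_of_nonneg_left (sub_nonneg.2 this)⟩
  -- On `S` the decreasing net `y (p₀ - p)` is constantly `y p₀`, so its infimum `0` forces `y p₀ =
  -- 0`.
  have hdec := (hy.2 S _ _ rfl (decreasesTo_sub_isLUB S hne p₀ hp₀)).2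
  refine ⟨p₀, p₀.2, hle, le_antisymm ?_ (mul_nonneg hy.1 p₀.2.1), fun p hp h1 h2 => ?_⟩
  · apply hdec.2.2
    rintro _ ⟨p, rfl⟩
    simp [mul_sub, p.2.2]
  · exact hp₀.1 (show (⟨p, hp⟩ : OI A) ∈ S from ⟨h1, h2⟩)

/-- Among the order idempotents `p ≤ q` with `p * y = 0` there is a largest one. -/
theorem exists_greatest_left_annihilator (hD : DedekindCompleteOI A) {y q : A}
    (hy : y ∈ orderContinuous A) (hq : q ∈ OI A) :
    ∃ p₀ ∈ OI A, p₀ ≤ q ∧ p₀ * y = 0 ∧ ∀ p ∈ OI A, p ≤ q → p * y = 0 → p ≤ p₀ := by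
  set S : Set (OI A) := {p | (p : A) ≤ q ∧ p * y = 0} with hSdef
  have hne : S.Nonempty := ⟨⟨0, zero_mem_OI⟩, hq.1, zero_mul y⟩
  obtain ⟨p₀, hp₀⟩ := hD S hne ⟨⟨q, hq⟩, fun p hp => hp.1⟩
  have hle : (p₀ : A) ≤ q := hp₀.2 (show (⟨q, hq⟩ : OI A) ∈ upperBounds S from fun p hp => hp.1)
  have hne' : Nonempty S := hne.to_subtype
  have hdir : IsDirectedOrder S := ⟨by
    rintro ⟨p, hp⟩ ⟨p', hp'⟩
    have hmem := OI_add_sub_mul_mem p.2 p'.2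
    refine ⟨⟨⟨_, hmem⟩, ?_, ?_⟩, ?_, ?_⟩
    · have e : q * ((p : A) + p' - p * p') = p + p' - p * p' := by
        rw [mul_sub, mul_add, ← mul_assoc, OI_mul_eq_of_le' p.2 hq hp.1,
          OI_mul_eq_of_le' p'.2 hq hp'.1]
      change ((p : A) + p' - p * p') ≤ q
      rw [← e]
      exact OI_mul_le_left hq hmem
    · change ((p : A) + p' - p * p') * y = 0
      rw [sub_mul, add_mul, mul_assoc, hp.2, hp'.2]; simp
    · change (p : A) ≤ p + p' - p * p'
      have := OI_mul_le_right p.2 p'.2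
      rw [add_sub_assoc]
      exact le_add_of_nonneg_right (sub_nonneg.2 this)
    · change (p' : A) ≤ p + p' - p * p'
      have := OI_mul_le_left p.2 p'.2
      rw [add_sub_right_comm]
      exact le_add_of_nonneg_left (sub_nonneg.2 this)⟩
  have hdec := (hy.2 S _ _ rfl (decreasesTo_sub_isLUB S hne p₀ hp₀)).1
  refine ⟨p₀, p₀.2, hle, le_antisymm ?_ (mul_nonneg p₀.2.1 hy.1), fun p hp h1 h2 => ?_⟩
  · apply hdec.2.2
    rintro _ ⟨p, rfl⟩
    simp [sub_mul, p.2.2]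
  · exact hp₀.1 (show (⟨p, hp⟩ : OI A) ∈ S from ⟨h1, h2⟩)

omit [IsOrderedRing A] in
theorem IrreducibleWrt.eq_zero_or_eq {b q p : A} (h : IrreducibleWrt b q) (hp : p ∈ OI A)
    (hpq : p ≤ q) (h0 : (q - p) * b * p = 0) : p = 0 ∨ p = q := by
  by_contra! hc
  exact h ⟨p, hp, hp.1.lt_of_ne hc.1.symm, hpq.lt_of_ne hc.2, h0⟩

/-- If `b` is irreducible and the right annihilator of `y ≠ 0` is `b`-invariant, then it is
trivial. -/
theorem IrreducibleWrt.right_faithful (hdis : DisjunctiveProduct A) (hD : DedekindCompleteOI A)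
    {b q y : A} (hq : q ∈ OI A) (hb : b ∈ orderContinuous A) (hirr : IrreducibleWrt b q)
    (hy : y ∈ orderContinuous A) (hyq : y * q = y) (hy0 : y ≠ 0)
    (hinv : ∀ p ∈ OI A, y * p = 0 → y * (b * p) = 0) {p : A} (hp : p ∈ OI A) (hpq : p ≤ q)
    (hyp : y * p = 0) : p = 0 := by
  obtain ⟨p₀, hp₀, hle, h0, hmax⟩ := exists_greatest_right_annihilator hD hy hq
  -- Disjunctivity of `y · (b p₀) = 0` gives `e` with `ye = 0`. Maximality puts `qe` below `p₀`, so
  -- `(1 - e) b p₀ = 0` makes `p₀` invariant under `b`.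
  obtain ⟨e, he, hye, heb⟩ := hdis y hy _ (orderContinuous_mul_right hb hp₀) (hinv p₀ hp₀ h0)
  have hqe : q * e ≤ p₀ :=
    hmax _ (OI_mul_mem hq he) (OI_mul_le_left hq he) (by rw [← mul_assoc, hyq, hye])
  have h1 : (q - p₀) * e = 0 := by
    have : p₀ * (q * e) = q * e := OI_mul_eq_of_le' (OI_mul_mem hq he) hp₀ hqe
    rw [sub_mul, ← this, ← mul_assoc, OI_mul_eq_of_le hp₀ hq hle, sub_self]
  have h2 : (q - p₀) * b * p₀ = 0 := by
    have : (q - p₀) * ((1 - e) * (b * p₀)) = 0 := by rw [heb, mul_zero]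
    rw [← mul_assoc, mul_sub, h1, mul_one, sub_zero] at this
    rw [mul_assoc, this]
  rcases hirr.eq_zero_or_eq hp₀ hle h2 with h | h
  · exact le_antisymm (h ▸ hmax p hp hpq hyp) hp.1
  · rw [h, hyq] at h0; exact absurd h0 hy0

/-- If `b` is irreducible and the left annihilator of `y ≠ 0` is `b`-invariant, then it is
trivial. -/
theorem IrreducibleWrt.left_faithful (hdis : DisjunctiveProduct A) (hD : DedekindCompleteOI A)
    {b q y : A} (hq : q ∈ OI A) (hb : b ∈ orderContinuous A) (hirr : IrreducibleWrt b q)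
    (hy : y ∈ orderContinuous A) (hqy : q * y = y) (hy0 : y ≠ 0)
    (hinv : ∀ p ∈ OI A, p * y = 0 → p * b * y = 0) {p : A} (hp : p ∈ OI A) (hpq : p ≤ q)
    (hyp : p * y = 0) : p = 0 := by
  obtain ⟨p₀, hp₀, hle, h0, hmax⟩ := exists_greatest_left_annihilator hD hy hq
  obtain ⟨e, he, hbe, hey⟩ := hdis _ (orderContinuous_mul_left hb hp₀) y hy (hinv p₀ hp₀ h0)
  have he' := one_sub_mem_OI he
  have hqe : (1 - e) * q ≤ p₀ :=
    hmax _ (OI_mul_mem he' hq) (OI_mul_le_right he' hq) (by rw [mul_assoc, hqy, hey])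
  have h1 : (1 - e) * (q - p₀) = 0 := by
    have : (1 - e) * q * p₀ = (1 - e) * q := OI_mul_eq_of_le (OI_mul_mem he' hq) hp₀ hqe
    rw [mul_sub, ← this, mul_assoc, OI_mul_eq_of_le' hp₀ hq hle, sub_self]
  -- On this side it is the complement `q - p₀` that is invariant under `b`.
  have h2 : (q - (q - p₀)) * b * (q - p₀) = 0 := by
    have h3 : q - p₀ = e * (q - p₀) := by
      rw [sub_mul, one_mul] at h1; exact sub_eq_zero.1 h1
    rw [sub_sub_cancel, h3, ← mul_assoc, hbe, zero_mul]
  rcases hirr.eq_zero_or_eq (OI_sub_mem hp₀ hq hle) (sub_le_self _ hp₀.1) h2 with h | h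
  · rw [← sub_eq_zero.1 h, hqy] at h0; exact absurd h0 hy0
  · rw [sub_eq_self] at h
    exact le_antisymm (h ▸ hmax p hp hpq hyp) hp.1

/-- An irreducible nilpotent element vanishes. -/
theorem IrreducibleWrt.eq_zero_of_pow_eq_zero [Nontrivial A] (hreg : OrderRegular A)
    (hdis : DisjunctiveProduct A) (hD : DedekindCompleteOI A)
    {b q : A} (hq : q ∈ OI A) (hb : b ∈ orderContinuous A) (hirr : IrreducibleWrt b q)
    (hqb : q * b = b) (hbq : b * q = b) {n : ℕ} (hn : b ^ n = 0) : b = 0 := by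
  induction n with
  | zero => rw [pow_zero] at hn; exact absurd hn one_ne_zero
  | succ n ih =>
    rcases n with _ | n
    · simpa using hn
    by_contra hb0
    have hx0 : b ^ (n + 1) ≠ 0 := fun h => hb0 (ih h)
    have hx := orderContinuous_pow hreg hb n
    have hxb : b ^ (n + 1) * b = 0 := by rw [← pow_succ, hn]
    have hxq : b ^ (n + 1) * q = b ^ (n + 1) := by rw [pow_succ, mul_assoc, hbq]
    -- The last nonzero power annihilates `b`, so its right annihilator is trivially invariant and
    -- hence zero below `q`; thus `qe = 0`.
    obtain ⟨e, he, hxe, heb⟩ := hdis _ hx _ hb hxb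
    have := hirr.right_faithful hdis hD hq hb hx hxq hx0
      (fun p _ _ => by rw [← mul_assoc, hxb, zero_mul]) (OI_mul_mem hq he) (OI_mul_le_left hq he)
      (by rw [← mul_assoc, hxq, hxe])
    apply hb0
    calc b = (1 - e) * b + e * q * b := by rw [mul_assoc, hqb]; noncomm_ring
      _ = 0 := by rw [heb, OI_mul_comm he hq, this]; simp

/-- If zero is irreducible with respect to `q ≠ 0`, then `q` is an atom, and it is a relatively
algebraically strictly positive order continuous projection. -/
theorem mem_rankOneProjections_of_irreducibleWrt_zero {q : A} (hq : q ∈ OI A) (hq0 : q ≠ 0)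
    (hirr : IrreducibleWrt 0 q) : q ∈ rankOneProjections A := by
  have hatom : ∀ p ∈ OI A, p ≤ q → p = 0 ∨ p = q := fun p hp hpq =>
    hirr.eq_zero_or_eq hp hpq (by simp)
  refine ⟨hq.2.2, ⟨hq.1, fun ι _ _ _ p z hz hp => ?_⟩, q, hq, hq0, by rw [hq.2.2, hq.2.2], ?_⟩
  -- Each `p i * q` is `0` or the atom `q`; if it were never `0`, `q` would be a nonzero lower bound
  -- of the net.
  · have hex : ∃ i, (p i : A) * q = 0 := by
      by_contra! hc
      have h1 : ∀ i, q ≤ p i := fun i => by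
        have := (hatom _ (OI_mul_mem (p i).2 hq) (OI_mul_le_right (p i).2 hq)).resolve_left (hc i)
        rw [← this]; exact OI_mul_le_left (p i).2 hq
      have h2 : (⟨q, hq⟩ : OI A) ≤ z := by
        apply hp.2.2
        rintro _ ⟨i, rfl⟩
        exact h1 i
      have h3 : q ≤ (z : A) := h2
      exact hq0 (le_antisymm (hz ▸ h3) hq.1)
    obtain ⟨i, hi⟩ := hex
    have hi' : q * (p i : A) = 0 := by rw [OI_mul_comm hq (p i).2, hi]
    refine ⟨⟨fun i j hij => mul_le_mul_of_nonneg_right (hp.1 hij) hq.1, ?_, fun w hw => ?_⟩,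
      ⟨fun i j hij => mul_le_mul_of_nonneg_left (hp.1 hij) hq.1, ?_, fun w hw => ?_⟩⟩
    · rintro _ ⟨i, rfl⟩; exact mul_nonneg (p i).2.1 hq.1
    · rw [← hi]; exact hw ⟨i, rfl⟩
    · rintro _ ⟨i, rfl⟩; exact mul_nonneg hq.1 (p i).2.1
    · rw [← hi']; exact hw ⟨i, rfl⟩
  · intro q₁ h1 q₂ h2 h1' h1q h2' h2q
    rw [(hatom q₁ h1 h1q).resolve_left h1'.ne', (hatom q₂ h2 h2q).resolve_left h2'.ne',
      hq.2.2, hq.2.2]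
    exact hq.1.lt_of_ne hq0.symm

/-! ### Block triangular elements. -/

/-- The blocks of a product of block triangular elements. -/
theorem block_mul_block {p p' x y : A} (hp : p ∈ OI A) (hp' : p' ∈ OI A)
    (hx : IsInvariant x p) (hy : IsInvariant y p') :
    p' * (1 - p) * x * (p' * (1 - p)) * y * (p' * (1 - p)) =
      p' * (1 - p) * (x * y) * (p' * (1 - p)) := by
  have hc := OI_mul_comm hp' (one_sub_mem_OI hp)
  have h1 : (1 - p) * x * (1 - p) = (1 - p) * x := by
    rw [mul_sub, mul_one, hx, sub_zero]
  have h2 : p' * y * p' = y * p' := by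
    have : (1 - p') * y * p' = 0 := hy
    rw [sub_mul, sub_mul, one_mul] at this
    exact (sub_eq_zero.1 this).symm
  -- Once the middle factor is commuted to `(1 - p) p'`, its halves are absorbed by `(1 - p) x` and
  -- `y p'`.
  calc p' * (1 - p) * x * (p' * (1 - p)) * y * (p' * (1 - p))
      = p' * ((1 - p) * x * (1 - p)) * (p' * y * p') * (1 - p) := by
        nth_rw 2 [hc]; noncomm_ring
    _ = _ := by rw [h1, h2]; noncomm_ring

omit [PartialOrder A] [IsOrderedRing A] in
theorem IsInvariant.mul {p x y : A} (hx : IsInvariant x p) (hy : IsInvariant y p) :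
    IsInvariant (x * y) p := by
  have h2 : p * y * p = y * p := by
    have : (1 - p) * y * p = 0 := hy
    rw [sub_mul, sub_mul, one_mul] at this
    exact (sub_eq_zero.1 this).symm
  have hx' : (1 - p) * x * p = 0 := hx
  calc (1 - p) * (x * y) * p = (1 - p) * x * (y * p) := by noncomm_ring
    _ = (1 - p) * x * p * y * p := by rw [← h2]; noncomm_ring
    _ = 0 := by rw [hx']; simp

omit [IsOrderedRing A] in
theorem IsInvariant.pow {p x : A} (hp : p ∈ OI A) (hx : IsInvariant x p) (n : ℕ) :
    IsInvariant (x ^ n) p := by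
  induction n with
  | zero => simp [IsInvariant, sub_mul, hp.2.2]
  | succ n ih => rw [pow_succ]; exact ih.mul hx

theorem block_pow {p p' x : A} (hp : p ∈ OI A) (hp' : p' ∈ OI A)
    (hx : IsInvariant x p) (hx' : IsInvariant x p') (n : ℕ) :
    (p' * (1 - p) * x * (p' * (1 - p))) ^ (n + 1) =
      p' * (1 - p) * x ^ (n + 1) * (p' * (1 - p)) := by
  have hqq := (OI_mul_mem hp' (one_sub_mem_OI hp)).2.2
  induction n with
  | zero => simp
  | succ n ih =>
    rw [pow_succ, ih, pow_succ x (n + 1), ← block_mul_block hp hp' (hx.pow hp _) hx']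
    set q := p' * (1 - p)
    calc q * x ^ (n + 1) * q * (q * x * q) = q * x ^ (n + 1) * (q * q) * x * q := by noncomm_ring
      _ = _ := by rw [hqq]

/-- A block triangular idempotent whose diagonal blocks lie in an ideal lies in that ideal. -/
theorem mem_of_blocks_mem (I : TwoSidedIdeal A) {n : ℕ} {p : Fin (n + 1) → A}
    (hp : ∀ i, p i ∈ OI A) (hp0 : p 0 = 0) (hp1 : p (Fin.last n) = 1)
    (hmono : ∀ i : Fin n, p i.castSucc ≤ p i.succ) {P : A} (hPP : P * P = P)
    (hinv : ∀ i, IsInvariant P (p i))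
    (hdiag : ∀ i : Fin n,
      p i.succ * (1 - p i.castSucc) * P * (p i.succ * (1 - p i.castSucc)) ∈ I) : P ∈ I := by
  have key : ∀ i, P * p i ∈ I := by
    intro i
    induction i using Fin.induction with
    | zero => rw [hp0, mul_zero]; exact I.zero_mem
    | succ i ih =>
      have hd := hdiag i
      set s := p i.succ
      set t := p i.castSucc
      have hst : s * t = t := OI_mul_eq_of_le' (hp _) (hp _) (hmono i)
      have e1 : s * P * s = P * s := by
        have : (1 - s) * P * s = 0 := hinv i.succ
        rw [sub_mul, sub_mul, one_mul] at this
        exact (sub_eq_zero.1 this).symm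
      have e2 : (1 - t) * P * t = 0 := hinv i.castSucc
      have e3 : s = t + s * (1 - t) := by rw [mul_sub, mul_one, hst]; abel
      -- Insert `P = P²` and split `s = t + s (1 - t)`: one term contains `P t`, known by induction,
      -- one is the diagonal block, and the mixed term vanishes by invariance.
      have : P * s = P * t * (P * s) + P * (s * (1 - t) * P * (s * (1 - t))) := by
        calc P * s = P * P * s := by rw [hPP]
          _ = P * (s * P * s) := by rw [e1, mul_assoc]
          _ = P * ((t + s * (1 - t)) * P * s) := by rw [← e3]
          _ = P * t * (P * s) + P * (s * (1 - t) * P * s) := by noncomm_ring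
          _ = P * t * (P * s) + P * (s * (1 - t) * P * (t + s * (1 - t))) := by rw [← e3]
          _ = P * t * (P * s) + P * (s * ((1 - t) * P * t) + s * (1 - t) * P * (s * (1 - t))) := by
            noncomm_ring
          _ = _ := by rw [e2, mul_zero, zero_add]
      rw [this]
      exact I.add_mem (I.mul_mem_right _ _ ih) (I.mul_mem_left _ _ hd)
  simpa [hp1] using key (Fin.last n)

/-- The ideal generated by the diagonal projections of a chain from `0` to `1` is everything. -/
theorem one_mem_of_blocks_mem (I : TwoSidedIdeal A) {n : ℕ} {p : Fin (n + 1) → A}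
    (hp : ∀ i, p i ∈ OI A) (hp0 : p 0 = 0) (hp1 : p (Fin.last n) = 1)
    (hmono : ∀ i : Fin n, p i.castSucc ≤ p i.succ)
    (hdiag : ∀ i : Fin n, p i.succ * (1 - p i.castSucc) ∈ I) : (1 : A) ∈ I := by
  refine mem_of_blocks_mem I hp hp0 hp1 hmono (mul_one 1) (fun i => ?_) fun i => ?_
  · simp [IsInvariant, sub_mul, (hp i).2.2]
  · rw [mul_one]; exact I.mul_mem_left _ _ (hdiag i)

/-! ### Laurent coefficients: algebra and uniqueness. -/

/-- Coefficients satisfying the algebraic relations of a Laurent expansion of a resolvent multiply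
like powers. -/
theorem laurentCoeff_mul {R : Type*} [Ring R] {N : R} {c : ℤ → R} {K : ℤ}
    (hK : ∀ j < K, c j = 0) (hl : ∀ j, c (j - 1) = N * c j + if j = 0 then 1 else 0)
    (hr : ∀ j, c (j - 1) = c j * N + if j = 0 then 1 else 0) {i j : ℤ} (hi : i < 0) (hj : j < 0) :
    c i * c j = c (i + j + 1) := by
  have hr' : ∀ i < 0, c i * N = c (i - 1) := fun i hi => by rw [hr i, if_neg hi.ne, add_zero]
  -- Moving a factor `N` from `c j` to `c i` lowers `i` and raises `j`; iterating pushes `i` below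
  -- `K`, where `c` vanishes.
  have hshift : ∀ n : ℕ, ∀ i < 0, ∀ j : ℤ, 0 ≤ j → c i * c j = c (i - n) * c (j + n) := by
    intro n
    induction n with
    | zero => intro i _ j _; simp
    | succ n ih =>
      intro i hi j hj
      rw [ih i hi j hj]
      have h2 : c (j + n) = N * c (j + n + 1) := by
        have := hl (j + n + 1)
        rwa [if_neg (by omega), add_zero, add_sub_cancel_right] at this
      rw [h2, ← mul_assoc, hr' _ (by omega)]
      push_cast
      congr 2 <;> ring
  have hzero : ∀ i < 0, ∀ j : ℤ, 0 ≤ j → c i * c j = 0 := by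
    intro i hi j hj
    rw [hshift (i - K + 1).toNat i hi j hj, hK _ (by omega), zero_mul]
  have key : ∀ n : ℕ, ∀ i < 0, c i * c (-1 - n) = c (i - n) := by
    intro n
    induction n with
    | zero =>
      intro i hi
      have := hl 0
      rw [if_pos rfl, zero_sub] at this
      -- From `c (-1) = N c 0 + 1`, the product `c i * c (-1)` is `c (i - 1) * c 0 + c i`, and the
      -- first term is zero.
      have h2 := hzero (i - 1) (by omega) 0 le_rfl
      rw [← hr' i hi, mul_assoc] at h2
      simp [this, mul_add, h2]
    | succ n ih =>
      intro i hi
      have h1 := hl (-1 - n)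
      rw [if_neg (by omega), add_zero] at h1
      have e : (-1 - ((n + 1 : ℕ) : ℤ)) = -1 - n - 1 := by push_cast; ring
      rw [e, h1, ← mul_assoc, hr' i hi, ih (i - 1) (by omega)]
      push_cast
      congr 1; ring
  have := key (-1 - j).toNat i hi
  have e : ((-1 - j).toNat : ℤ) = -1 - j := by omega
  rw [e] at this
  rw [show j = -1 - (-1 - j) by ring, this]
  congr 1; ring

end Order

end OrderedBanachAlg

namespace OrderedBanachAlg

section LaurentSeries

variable {E : Type*} [NormedAddCommGroup E] [NormedSpace ℝ E] [CompleteSpace E]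

/-- The lowest coefficient of a Laurent series is the limit of the rescaled sum. -/
theorem tendsto_of_hasSum_zpow {c : ℤ → E} {m : ℤ} (hm : ∀ j < m, c j = 0) {g : ℝ → E}
    (hg : ∀ᶠ t : ℝ in 𝓝[>] 0, HasSum (fun j : ℤ => t ^ j • c j) (g t)) :
    Tendsto (fun t : ℝ => t ^ (-m) • g t) (𝓝[>] 0) (𝓝 (c m)) := by
  have hg' : ∀ᶠ t : ℝ in 𝓝[>] 0,
      0 < t ∧ HasSum (fun n : ℕ => t ^ n • c (m + n)) (t ^ (-m) • g t) := by
    filter_upwards [hg, self_mem_nhdsWithin] with t ht ht0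
    have ht0' : (0 : ℝ) < t := ht0
    refine ⟨ht0', ?_⟩
    have hinj : Function.Injective (fun n : ℕ => m + (n : ℤ)) := fun x y h => by
      simpa using h
    have h1 : HasSum ((fun j : ℤ => t ^ j • c j) ∘ fun n : ℕ => m + (n : ℤ)) (g t) := by
      rw [hinj.hasSum_iff]
      · exact ht
      · intro j hj
        rw [hm j, smul_zero]
        by_contra! h
        exact hj ⟨(j - m).toNat, by simp [Int.toNat_of_nonneg (sub_nonneg.2 h)]⟩
    refine (h1.const_smul (t ^ (-m))).congr_fun ?_
    intro n
    rw [Function.comp_apply, smul_smul, ← zpow_add₀ ht0'.ne', neg_add_cancel_left, zpow_natCast]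
  obtain ⟨t₀, ht₀, hs₀⟩ := hg'.exists
  -- Convergence at the single point `t₀` bounds `t₀ ^ n ‖c (m + n)‖`, so a geometric series of
  -- ratio `1/2` dominates for `t < t₀ / 2`.
  obtain ⟨M, hM⟩ := (hs₀.summable.tendsto_atTop_zero.norm).bddAbove_range
  have hM' : ∀ n : ℕ, t₀ ^ n * ‖c (m + n)‖ ≤ M := fun n => by
    have := hM ⟨n, rfl⟩
    simpa [norm_smul, abs_of_pos ht₀] using this
  have hlim : Tendsto (fun t : ℝ => ∑' n : ℕ, t ^ n • c (m + n)) (𝓝[>] 0)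
      (𝓝 (∑' n : ℕ, (0 : ℝ) ^ n • c (m + n))) := by
    refine tendsto_tsum_of_dominated_convergence (bound := fun n => M * (1 / 2) ^ n)
      (summable_geometric_two.mul_left M) (fun n => ?_) ?_
    · have : Continuous fun t : ℝ => t ^ n • c (m + n) := by fun_prop
      exact (this.tendsto 0).mono_left nhdsWithin_le_nhds
    · filter_upwards [Ioo_mem_nhdsGT (half_pos ht₀)] with t ht n
      rw [norm_smul, norm_pow, Real.norm_of_nonneg ht.1.le]
      calc t ^ n * ‖c (m + n)‖ ≤ (t₀ / 2) ^ n * ‖c (m + n)‖ :=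
            mul_le_mul_of_nonneg_right (pow_le_pow_left₀ ht.1.le ht.2.le n) (norm_nonneg _)
        _ = t₀ ^ n * ‖c (m + n)‖ * (1 / 2) ^ n := by rw [div_pow, one_div, inv_pow]; ring
        _ ≤ M * (1 / 2) ^ n := mul_le_mul_of_nonneg_right (hM' n) (by positivity)
  have h0 : (∑' n : ℕ, (0 : ℝ) ^ n • c (m + n)) = c m := by
    rw [tsum_eq_single 0]
    · simp
    · intro n hn; rw [zero_pow hn, zero_smul]
  rw [h0] at hlim
  exact hlim.congr' (by filter_upwards [hg'] with t ht using ht.2.tsum_eq)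

/-- The coefficients of a Laurent series with sum zero vanish. -/
theorem eq_zero_of_hasSum_zpow_zero {c : ℤ → E} {K : ℤ} (hK : ∀ j < K, c j = 0)
    (hg : ∀ᶠ t : ℝ in 𝓝[>] 0, HasSum (fun j : ℤ => t ^ j • c j) 0) (j : ℤ) : c j = 0 := by
  by_contra hj
  obtain ⟨m, hm, hmin⟩ := Int.exists_least_of_bdd (P := fun j => c j ≠ 0)
    ⟨K, fun z hz => by by_contra! h; exact hz (hK z h)⟩ ⟨j, hj⟩
  have := tendsto_of_hasSum_zpow (c := c) (m := m)
    (fun i hi => by by_contra h; exact absurd (hmin i h) (not_le.2 hi)) hg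
  simp only [smul_zero] at this
  exact hm (tendsto_nhds_unique this tendsto_const_nhds)

end LaurentSeries

/-! ### The resolvent and its Laurent coefficients. -/

section Banach

variable {A : Type u} [NormedRing A] [NormedAlgebra ℂ A] [CompleteSpace A]

theorem ofReal_specRadius [Nontrivial A] (a : A) :
    ENNReal.ofReal (specRadius a) = spectralRadius ℂ a := by
  refine ENNReal.ofReal_toReal (ne_top_of_le_ne_top ?_
    (spectrum.spectralRadius_le_pow_nnnorm_pow_one_div ℂ a 0))
  simp [ENNReal.mul_ne_top]

/-- The Neumann series of the resolvent. -/
theorem hasSum_resolvent [Nontrivial A] {a : A} {s : ℝ} (hs : specRadius a < s) :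
    HasSum (fun n : ℕ => (s⁻¹ • a) ^ n) (s • resolvent a (s : ℂ)) ∧
      ((s : ℂ) ∈ resolventSet ℂ a) := by
  have hr0 : 0 ≤ specRadius a := ENNReal.toReal_nonneg
  have hs0 : 0 < s := hr0.trans_lt hs
  -- Gelfand's formula yields `‖a ^ n‖ ≤ ρ ^ n` eventually, for any `ρ` strictly between the
  -- spectral radius and `s`.
  obtain ⟨ρ, hρ, hρs⟩ := exists_between hs
  have hρ0 : 0 < ρ := hr0.trans_lt hρ
  have hlt : spectralRadius ℂ a < ENNReal.ofReal ρ := by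
    rw [← ofReal_specRadius]; exact (ENNReal.ofReal_lt_ofReal_iff hρ0).2 hρ
  have hev := (spectrum.pow_norm_pow_one_div_tendsto_nhds_spectralRadius a).eventually_lt_const hlt
  have hsum : Summable (fun n : ℕ => (s⁻¹ • a) ^ n) := by
    refine Summable.of_norm_bounded_eventually_nat (g := fun n => (ρ / s) ^ n)
      (summable_geometric_of_lt_one (by positivity) ((div_lt_one hs0).2 hρs)) ?_
    filter_upwards [hev, eventually_gt_atTop 0] with n hn hn0
    have h1 : ‖a ^ n‖ ^ (1 / n : ℝ) ≤ ρ := ((ENNReal.ofReal_lt_ofReal_iff hρ0).1 hn).le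
    have h2 : ‖a ^ n‖ ≤ ρ ^ n := by
      have := pow_le_pow_left₀ (by positivity) h1 n
      rwa [one_div, Real.rpow_inv_natCast_pow (norm_nonneg _) hn0.ne'] at this
    rw [smul_pow, norm_smul, norm_pow, norm_inv, Real.norm_of_nonneg hs0.le, div_pow, inv_pow,
      div_eq_inv_mul]
    exact mul_le_mul_of_nonneg_left h2 (by positivity)
  have e : algebraMap ℂ A s - a = s • (1 - s⁻¹ • a) := by
    rw [smul_sub, smul_smul, mul_inv_cancel₀ hs0.ne', one_smul, Algebra.algebraMap_eq_smul_one,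
      Complex.coe_smul]
  set T := ∑' n : ℕ, (s⁻¹ • a) ^ n
  let v : Aˣ := ⟨s • (1 - s⁻¹ • a), s⁻¹ • T,
    by rw [smul_mul_smul_comm, hsum.one_sub_mul_tsum_pow, mul_inv_cancel₀ hs0.ne', one_smul],
    by rw [smul_mul_smul_comm, hsum.tsum_pow_mul_one_sub, inv_mul_cancel₀ hs0.ne', one_smul]⟩
  have hv : (v : A) = algebraMap ℂ A s - a := e.symm
  have hres : resolvent a (s : ℂ) = s⁻¹ • T := by
    rw [resolvent, ← hv, Ring.inverse_unit]; rfl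
  refine ⟨?_, ?_⟩
  · rw [hres, smul_smul, mul_inv_cancel₀ hs0.ne', one_smul]
    exact hsum.hasSum
  · rw [spectrum.mem_resolventSet_iff, ← hv]; exact v.isUnit

theorem resolvent_mul [Nontrivial A] {a : A} {r t : ℝ} (hs : specRadius a < r + t) :
    (a - algebraMap ℝ A r) * resolvent a ((r + t : ℝ) : ℂ)
      = t • resolvent a ((r + t : ℝ) : ℂ) - 1 ∧
    resolvent a ((r + t : ℝ) : ℂ) * (a - algebraMap ℝ A r)
      = t • resolvent a ((r + t : ℝ) : ℂ) - 1 := by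
  have hu := spectrum.mem_resolventSet_iff.1 (hasSum_resolvent hs).2
  have h1 := Ring.mul_inverse_cancel _ hu
  have h2 := Ring.inverse_mul_cancel _ hu
  change _ * resolvent a ((r + t : ℝ) : ℂ) = 1 at h1
  change resolvent a ((r + t : ℝ) : ℂ) * _ = 1 at h2
  have e : algebraMap ℂ A ((r + t : ℝ) : ℂ) = algebraMap ℝ A r + algebraMap ℝ A t := by
    rw [← map_add, Algebra.algebraMap_eq_smul_one, Algebra.algebraMap_eq_smul_one,
      Complex.coe_smul]
  rw [e] at h1 h2
  constructor
  · rw [Algebra.smul_def, ← h1]; noncomm_ring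
  · rw [Algebra.smul_def, Algebra.commutes, ← h2]; noncomm_ring

omit [NormedAlgebra ℂ A] [CompleteSpace A] in
theorem IsInvariant.of_hasSum {ι : Type*} {f : ι → A} {x p : A} (hf : ∀ i, IsInvariant (f i) p)
    (h : HasSum f x) : IsInvariant x p := by
  have := (h.mul_left (1 - p)).mul_right p
  rw [show (fun i => (1 - p) * f i * p) = fun _ => 0 from funext hf] at this
  exact this.unique hasSum_zero

omit [CompleteSpace A] in
theorem IsInvariant.smul {a p : A} (h : IsInvariant a p) (s : ℝ) : IsInvariant (s • a) p := by
  have : (1 - p) * a * p = 0 := h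
  rw [IsInvariant, mul_smul_comm, smul_mul_assoc, this, smul_zero]

omit [CompleteSpace A] in
/-- The expansion of the resolvent on the real half-line to the right of the pole. -/
theorem IsResolventPole.hasSum_real {a : A} {r : ℝ} {k : ℕ} {c : ℤ → A}
    (h : IsResolventPole a (r : ℂ) k c) :
    ∀ᶠ t : ℝ in 𝓝[>] 0, HasSum (fun j : ℤ => t ^ j • c j) (resolvent a ((r + t : ℝ) : ℂ)) := by
  have ht : Tendsto (fun t : ℝ => ((r + t : ℝ) : ℂ)) (𝓝[>] 0) (𝓝[≠] (r : ℂ)) := by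
    refine tendsto_nhdsWithin_iff.2 ⟨?_, ?_⟩
    · have : Continuous fun t : ℝ => ((r + t : ℝ) : ℂ) := by fun_prop
      have := this.tendsto 0
      rw [add_zero] at this
      exact this.mono_left nhdsWithin_le_nhds
    · filter_upwards [self_mem_nhdsWithin] with t ht
      have ht0 : (0 : ℝ) < t := ht
      simpa using ht0.ne'
  filter_upwards [ht.eventually h.laurent] with t ht
  refine ht.congr_fun fun j => ?_
  rw [Complex.ofReal_add, add_sub_cancel_left, ← Complex.ofReal_zpow, Complex.coe_smul]

omit [CompleteSpace A] in
theorem hasSum_zpow_shift {c : ℤ → A} {t : ℝ} (ht : 0 < t) {x : A}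
    (h : HasSum (fun j : ℤ => t ^ j • c j) x) :
    HasSum (fun j : ℤ => t ^ j • c (j - 1)) (t • x) := by
  have h1 := ((Equiv.subRight (1 : ℤ)).hasSum_iff.2 h).const_smul t
  refine h1.congr_fun fun j => ?_
  simp only [Function.comp_apply, Equiv.subRight_apply]
  rw [smul_smul, ← zpow_one_add₀ ht.ne', add_sub_cancel]

/-- The algebraic relations between the Laurent coefficients of the resolvent. -/
theorem IsResolventPole.coeff_rec [Nontrivial A] {a : A} {k : ℕ} {c : ℤ → A}
    (h : IsResolventPole a (specRadius a : ℂ) k c) (j : ℤ) :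
    c (j - 1) = (a - algebraMap ℝ A (specRadius a)) * c j + (if j = 0 then 1 else 0) ∧
    c (j - 1) = c j * (a - algebraMap ℝ A (specRadius a)) + (if j = 0 then 1 else 0) := by
  set N := a - algebraMap ℝ A (specRadius a) with hN
  have h1 : ∀ t : ℝ, HasSum (fun j : ℤ => t ^ j • (if j = 0 then (1 : A) else 0)) 1 := fun t => by
    convert hasSum_single (0 : ℤ) _ using 1
    · simp
    · intro j hj; simp [hj]
  have hz : ∀ j < -(k : ℤ), c j = 0 ∧ c (j - 1) = 0 ∧ (if j = 0 then (1 : A) else 0) = 0 :=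
    fun j hj => ⟨h.eq_zero j hj, h.eq_zero _ (by omega), if_neg (by omega)⟩
  -- Both recursions compare coefficients in `t R - N R - 1 = 0` and `t R - R N - 1 = 0`, where `R`
  -- is the resolvent at `r(a) + t`.
  constructor
  · have := eq_zero_of_hasSum_zpow_zero (K := -(k : ℤ))
      (c := fun j => c (j - 1) - N * c j - (if j = 0 then (1 : A) else 0))
      (fun j hj => by simp only [hz j hj, mul_zero, sub_zero]) ?_ j
    · rw [sub_sub] at this; exact sub_eq_zero.1 this
    · filter_upwards [h.hasSum_real, self_mem_nhdsWithin] with t ht ht0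
      have ht0' : (0 : ℝ) < t := ht0
      have hR := (resolvent_mul (a := a) (r := specRadius a) (t := t) (by linarith)).1
      have := ((hasSum_zpow_shift ht0' ht).sub (ht.mul_left N)).sub (h1 t)
      rw [hR, sub_sub_cancel, sub_self] at this
      refine this.congr_fun fun j => ?_
      rw [smul_sub, smul_sub, mul_smul_comm]
  · have := eq_zero_of_hasSum_zpow_zero (K := -(k : ℤ))
      (c := fun j => c (j - 1) - c j * N - (if j = 0 then (1 : A) else 0))
      (fun j hj => by simp only [hz j hj, zero_mul, sub_zero]) ?_ j
    · rw [sub_sub] at this; exact sub_eq_zero.1 this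
    · filter_upwards [h.hasSum_real, self_mem_nhdsWithin] with t ht ht0
      have ht0' : (0 : ℝ) < t := ht0
      have hR := (resolvent_mul (a := a) (r := specRadius a) (t := t) (by linarith)).2
      have := ((hasSum_zpow_shift ht0' ht).sub (ht.mul_right N)).sub (h1 t)
      rw [hR, sub_sub_cancel, sub_self] at this
      refine this.congr_fun fun j => ?_
      rw [smul_sub, smul_sub, smul_mul_assoc]

variable [PartialOrder A] [IsOrderedRing A]

omit [IsOrderedRing A] in
theorem isInvariant_resolvent [Nontrivial A] {a p : A} (hp : p ∈ OI A) (h : IsInvariant a p)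
    {s : ℝ} (hs : specRadius a < s) : IsInvariant (resolvent a (s : ℂ)) p := by
  have hs0 : 0 < s := lt_of_le_of_lt ENNReal.toReal_nonneg hs
  have := (IsInvariant.of_hasSum (fun n => (h.smul s⁻¹).pow hp n) (hasSum_resolvent hs).1).smul s⁻¹
  rwa [smul_smul, inv_mul_cancel₀ hs0.ne', one_smul] at this

omit [IsOrderedRing A] in
theorem IsResolventPole.isInvariant_coeff [Nontrivial A] {a p : A} {k : ℕ} {c : ℤ → A}
    (h : IsResolventPole a (specRadius a : ℂ) k c) (hp : p ∈ OI A) (hinv : IsInvariant a p)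
    (j : ℤ) : IsInvariant (c j) p := by
  refine eq_zero_of_hasSum_zpow_zero (K := -(k : ℤ)) (c := fun j => (1 - p) * c j * p)
    (fun j hj => by simp only [h.eq_zero j hj, mul_zero, zero_mul]) ?_ j
  filter_upwards [h.hasSum_real, self_mem_nhdsWithin] with t ht ht0
  have ht0' : (0 : ℝ) < t := ht0
  have hR : (1 - p) * resolvent a ((specRadius a + t : ℝ) : ℂ) * p = 0 :=
    isInvariant_resolvent hp hinv (by linarith)
  have := (ht.mul_left (1 - p)).mul_right p
  rw [hR] at this
  refine this.congr_fun fun j => ?_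
  rw [mul_smul_comm, smul_mul_assoc]

/-- A diagonal block of a block triangular element has no larger spectral radius. -/
theorem spectralRadius_block_le {a p p' : A} (hp : p ∈ OI A) (hp' : p' ∈ OI A)
    (h : IsInvariant a p) (h' : IsInvariant a p') :
    spectralRadius ℂ (p' * (1 - p) * a * (p' * (1 - p))) ≤ spectralRadius ℂ a := by
  set q := p' * (1 - p) with hq
  have h1 := spectrum.pow_nnnorm_pow_one_div_tendsto_nhds_spectralRadius (q * a * q)
  have h2 := spectrum.pow_nnnorm_pow_one_div_tendsto_nhds_spectralRadius a
  -- The summand `1` keeps `C` positive even for `q = 0`, so that `C ^ (1 / n)` tends to `1`.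
  set C : ENNReal := ((‖q‖₊ * ‖q‖₊ + 1 : NNReal) : ENNReal) with hC
  have hC0 : C ≠ 0 := by
    rw [hC, ENNReal.coe_ne_zero]; positivity
  have hCt : C ≠ ⊤ := ENNReal.coe_ne_top
  have h3 : Tendsto (fun n : ℕ => C ^ (1 / n : ℝ)) atTop (𝓝 1) := by
    have h4 : Tendsto (fun n : ℕ => (1 / n : ℝ)) atTop (𝓝 0) := tendsto_one_div_atTop_nhds_zero_nat
    have h5 : Tendsto (fun n : ℕ => (‖q‖₊ * ‖q‖₊ + 1 : NNReal) ^ (1 / n : ℝ)) atTop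
        (𝓝 ((‖q‖₊ * ‖q‖₊ + 1 : NNReal) ^ (0 : ℝ))) :=
      tendsto_const_nhds.nnrpow h4 (Or.inl (by positivity))
    rw [NNReal.rpow_zero] at h5
    have h6 := ENNReal.tendsto_coe.2 h5
    rw [ENNReal.coe_one] at h6
    refine h6.congr fun n => ?_
    rw [hC, ENNReal.coe_rpow_of_nonneg _ (by positivity)]
  have h4 := ENNReal.Tendsto.mul h3 (Or.inl one_ne_zero) h2 (Or.inr ENNReal.one_ne_top)
  rw [one_mul] at h4
  refine le_of_tendsto_of_tendsto h1 h4 ?_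
  filter_upwards [eventually_gt_atTop 0] with n hn
  obtain ⟨n, rfl⟩ := Nat.exists_eq_succ_of_ne_zero hn.ne'
  rw [← ENNReal.mul_rpow_of_nonneg _ _ (by positivity)]
  refine ENNReal.rpow_le_rpow ?_ (by positivity)
  rw [hC, ← ENNReal.coe_mul, ENNReal.coe_le_coe, hq, Nat.succ_eq_add_one, block_pow hp hp' h h', ← hq]
  calc ‖q * a ^ (n + 1) * q‖₊ ≤ ‖q‖₊ * ‖a ^ (n + 1)‖₊ * ‖q‖₊ :=
        (nnnorm_mul_le _ _).trans (mul_le_mul_left (nnnorm_mul_le _ _) _)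
    _ = ‖q‖₊ * ‖q‖₊ * ‖a ^ (n + 1)‖₊ := by ring
    _ ≤ (‖q‖₊ * ‖q‖₊ + 1) * ‖a ^ (n + 1)‖₊ := mul_le_mul_left (le_add_of_nonneg_right zero_le_one) _

variable [PosSMulMono ℝ A] [OrderClosedTopology A]

omit [CompleteSpace A] [OrderClosedTopology A] [IsOrderedRing A] in
theorem orderContinuous_smul {a : A} (ha : a ∈ orderContinuous A) {s : ℝ} (hs : 0 ≤ s) :
    s • a ∈ orderContinuous A := by
  rcases hs.eq_or_lt with rfl | hs
  · rw [zero_smul]; exact zero_mem_orderContinuous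
  have key : ∀ {ι : Type u} [Preorder ι] {x : ι → A}, DecreasesTo x 0 →
      DecreasesTo (fun i => s • x i) 0 := by
    intro ι _ x hx
    refine ⟨fun i j hij => smul_le_smul_of_nonneg_left (hx.1 hij) hs.le, ?_, fun w hw => ?_⟩
    · rintro _ ⟨i, rfl⟩; exact smul_nonneg hs.le (hx.2.1 ⟨i, rfl⟩)
    · have : s⁻¹ • w ≤ 0 := by
        apply hx.2.2
        rintro _ ⟨i, rfl⟩
        have := smul_le_smul_of_nonneg_left (hw ⟨i, rfl⟩) (inv_nonneg.2 hs.le)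
        simpa [smul_smul, inv_mul_cancel₀ hs.ne'] using this
      have := smul_le_smul_of_nonneg_left this hs.le
      simpa [smul_smul, mul_inv_cancel₀ hs.ne'] using this
  refine ⟨smul_nonneg hs.le ha.1, fun ι _ _ _ p z hz hp => ?_⟩
  simp only [mul_smul_comm, smul_mul_assoc]
  exact ⟨key (ha.2 ι p z hz hp).1, key (ha.2 ι p z hz hp).2⟩

omit [OrderClosedTopology A] in
-- The factor `a` turns the identity term of the Neumann series into `a`: `1` need not be order
-- continuous, as an infimum in `OI A` need not be one in `A`.
theorem mul_resolvent_mem_orderContinuous [Nontrivial A] (hreg : OrderRegular A)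
    (hcl : IsClosed (orderContinuous A)) {a : A} (ha : a ∈ orderContinuous A) {s : ℝ}
    (hs : specRadius a < s) : a * resolvent a (s : ℂ) ∈ orderContinuous A := by
  have hs0 : 0 < s := lt_of_le_of_lt ENNReal.toReal_nonneg hs
  have h1 := ((hasSum_resolvent hs).1.mul_left a).const_smul s⁻¹
  rw [mul_smul_comm, smul_smul, inv_mul_cancel₀ hs0.ne', one_smul] at h1
  refine hcl.mem_of_tendsto h1 (Eventually.of_forall fun F => orderContinuous_sum F fun n _ => ?_)
  rw [smul_pow, mul_smul_comm, ← pow_succ']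
  have hs' : 0 ≤ s⁻¹ := inv_nonneg.2 hs0.le
  exact orderContinuous_smul (orderContinuous_smul (orderContinuous_pow hreg ha n)
    (pow_nonneg hs' n)) hs'

/-- All Neumann terms are positive, so `a ^ k ≤ t · t ^ k R(t)`, and the right side tends to `0 · c
(-k) = 0`. -/
theorem pow_eq_zero_of_isResolventPole_zero [Nontrivial A] {a : A} (ha : 0 ≤ a) {k : ℕ}
    {c : ℤ → A} (h : IsResolventPole a (specRadius a : ℂ) k c) (h0 : specRadius a = 0) :
    a ^ k = 0 := by
  have hlim := tendsto_of_hasSum_zpow h.eq_zero h.hasSum_real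
  have hid : Tendsto (fun t : ℝ => t) (𝓝[>] 0) (𝓝 0) := nhdsWithin_le_nhds
  have hlim2 := hid.smul hlim
  rw [zero_smul] at hlim2
  refine le_antisymm (ge_of_tendsto hlim2 ?_) (pow_nonneg ha k)
  filter_upwards [self_mem_nhdsWithin] with t ht
  have ht0 : (0 : ℝ) < t := ht
  have hs : specRadius a < specRadius a + t := by linarith
  have h1 := le_hasSum (hasSum_resolvent hs).1 k fun n _ =>
    pow_nonneg (smul_nonneg (inv_nonneg.2 (by linarith)) ha) n
  rw [h0, zero_add] at h1 ⊢
  have h2 := smul_le_smul_of_nonneg_left h1 (pow_nonneg ht0.le k)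
  rw [smul_pow, smul_smul, ← mul_pow, mul_inv_cancel₀ ht0.ne', one_pow, one_smul] at h2
  rw [neg_neg, zpow_natCast, smul_comm]
  exact h2

omit [CompleteSpace A] [PosSMulMono ℝ A] [OrderClosedTopology A] in
/-- Positive order continuous eigenvectors of irreducible elements are strictly positive. -/
theorem IrreducibleWrt.mul_mul_ne_zero (hA : AxiomA1 A) {b q x : A} {r : ℝ} (hq : q ∈ OI A)
    (hb : b ∈ orderContinuous A) (hirr : IrreducibleWrt b q) (hx : x ∈ orderContinuous A)
    (hqx : q * x = x) (hxq : x * q = x) (hx0 : x ≠ 0) (hbx : b * x = r • x) (hxb : x * b = r • x)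
    {q₁ q₂ : A} (h₁ : q₁ ∈ OI A) (h₂ : q₂ ∈ OI A) (h₁0 : q₁ ≠ 0) (h₁q : q₁ ≤ q) (h₂0 : q₂ ≠ 0)
    (h₂q : q₂ ≤ q) : q₁ * x * q₂ ≠ 0 := by
  -- By right faithfulness `x q₂` is nonzero; it is still an eigenvector under left multiplication
  -- by `b`, so left faithfulness applies to it.
  have h3 : x * q₂ ≠ 0 := fun h => h₂0 <|
    hirr.right_faithful hA.disjunctive hA.dedekind hq hb hx hxq hx0
      (fun p _ hp => by rw [← mul_assoc, hxb, smul_mul_assoc, hp, smul_zero]) h₂ h₂q h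
  intro h
  refine h₁0 (hirr.left_faithful hA.disjunctive hA.dedekind hq hb
    (orderContinuous_mul_right hx h₂) (by rw [← mul_assoc, hqx]) h3
      (fun p _ hp => ?_) h₁ h₁q (by rw [← mul_assoc, h]))
  rw [mul_assoc, ← mul_assoc b, hbx, smul_mul_assoc, mul_smul_comm, hp, smul_zero]

omit [CompleteSpace A] [PosSMulMono ℝ A] [OrderClosedTopology A] in
-- If `x² = 0`, disjunctivity gives `e` with `xe = (1 - e)x = 0`; right faithfulness kills `qe`, and
-- then `x = 0`.
theorem IrreducibleWrt.mul_self_ne_zero (hA : AxiomA1 A) {b q x : A} {r : ℝ} (hq : q ∈ OI A)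
    (hb : b ∈ orderContinuous A) (hirr : IrreducibleWrt b q) (hx : x ∈ orderContinuous A)
    (hqx : q * x = x) (hxq : x * q = x) (hx0 : x ≠ 0) (hxb : x * b = r • x) :
    x * x ≠ 0 := by
  intro h
  obtain ⟨e, he, hxe, hex⟩ := hA.disjunctive x hx x hx h
  have := hirr.right_faithful hA.disjunctive hA.dedekind hq hb hx hxq hx0
      (fun p _ hp => by rw [← mul_assoc, hxb, smul_mul_assoc, hp, smul_zero])
      (OI_mul_mem hq he) (OI_mul_le_left hq he) (by rw [← mul_assoc, hxq, hxe])
  apply hx0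
  calc x = (1 - e) * x + e * q * x := by rw [mul_assoc, hqx]; noncomm_ring
    _ = 0 := by rw [hex, OI_mul_comm he hq, this]; simp

end Banach

end OrderedBanachAlg

namespace OrderedBanachAlg

/-! ### Diagonal blocks of the residue and the conclusion. -/

section Main

variable {A : Type u} [NormedRing A] [NormedAlgebra ℂ A] [CompleteSpace A] [Nontrivial A]
  [PartialOrder A] [IsOrderedRing A] [PosSMulMono ℝ A] [OrderClosedTopology A]

omit [CompleteSpace A] [Nontrivial A] [PartialOrder A] [IsOrderedRing A] [PosSMulMono ℝ A]
  [OrderClosedTopology A] in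
theorem le_spectralRadius_of_mul_eq_smul {b x : A} {r : ℝ} (hr : 0 ≤ r) (hx : x ≠ 0)
    (hbx : b * x = r • x) : ENNReal.ofReal r ≤ spectralRadius ℂ b := by
  have hmem : (r : ℂ) ∈ spectrum ℂ b := by
    intro hu
    have h1 : (algebraMap ℂ A r - b) * x = 0 := by
      rw [sub_mul, hbx, Algebra.algebraMap_eq_smul_one, Complex.coe_smul, smul_mul_assoc, one_mul,
        sub_self]
    exact hx ((hu.mul_right_eq_zero).1 h1)
  have h2 : (‖(r : ℂ)‖₊ : ENNReal) ≤ spectralRadius ℂ b :=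
    le_iSup₂ (f := fun (k : ℂ) (_ : k ∈ spectrum ℂ b) => (‖k‖₊ : ENNReal)) (r : ℂ) hmem
  rwa [← enorm_eq_nnnorm, ← ofReal_norm, Complex.norm_real, Real.norm_of_nonneg hr] at h2

omit [OrderClosedTopology A] in
/-- The diagonal blocks of the residue that do not vanish are relatively algebraically
strictly positive order continuous projections. -/
theorem block_residue_mem (hA : AxiomA1 A) {a : A} (ha : a ∈ orderContinuous A) {k : ℕ} {c : ℤ → A}
    (hpole : IsResolventPole a (specRadius a : ℂ) k c) (hr : 0 < specRadius a)
    {p p' q : A} (hp : p ∈ OI A) (hp' : p' ∈ OI A) (hinv : IsInvariant a p)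
    (hinv' : IsInvariant a p') (hqdef : q = p' * (1 - p))
    (hirr : spectralRadius ℂ (q * a * q) = spectralRadius ℂ a → IrreducibleWrt (q * a * q) q)
    (h0 : q * c (-1) * q ≠ 0) : q * c (-1) * q ∈ rankOneProjections A := by
  set r := specRadius a with hrdef
  have hq : q ∈ OI A := hqdef ▸ OI_mul_mem hp' (one_sub_mem_OI hp)
  have hqq : q * q = q := hq.2.2
  have hcoef := hpole.coeff_rec
  have hblock : ∀ x y : A, IsInvariant x p → IsInvariant y p' →
      q * x * q * y * q = q * (x * y) * q := fun x y hx hy => by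
    rw [hqdef]; exact block_mul_block hp hp' hx hy
  have hcp : ∀ j, IsInvariant (c j) p := hpole.isInvariant_coeff hp hinv
  have hcp' : ∀ j, IsInvariant (c j) p' := hpole.isInvariant_coeff hp' hinv'
  obtain ⟨m, hm, hmin⟩ := Int.exists_least_of_bdd (P := fun j => q * c j * q ≠ 0)
    ⟨-(k : ℤ), fun z hz => by
      by_contra! h
      exact hz (by rw [hpole.eq_zero z h, mul_zero, zero_mul])⟩ ⟨-1, h0⟩
  have hlow : ∀ j < m, q * c j * q = 0 := fun j hj => by
    by_contra h
    exact absurd (hmin j h) (not_le.2 hj)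
  have hm1 : m ≤ -1 := hmin (-1) h0
  have hac : ∀ j < 0, a * c j = r • c j + c (j - 1) ∧ c j * a = r • c j + c (j - 1) := by
    intro j hj
    obtain ⟨h1, h2⟩ := hcoef j
    rw [if_neg hj.ne, add_zero] at h1 h2
    constructor
    · rw [h1, sub_mul, ← Algebra.smul_def, add_sub_cancel]
    · rw [h2, mul_sub, ← Algebra.commutes, ← Algebra.smul_def, add_sub_cancel]
  set x := q * c m * q with hx
  have hqx : q * x = x := by rw [hx, ← mul_assoc, ← mul_assoc, hqq]
  have hxq : x * q = x := by rw [hx, mul_assoc, hqq]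
  have hbx : q * a * q * x = r • x := by
    calc q * a * q * x = q * a * (q * q) * c m * q := by rw [hx]; noncomm_ring
      _ = r • x := by
        rw [hqq, hblock _ _ hinv (hcp' m), (hac m (by omega)).1, mul_add, add_mul,
          hlow _ (by omega), add_zero, mul_smul_comm, smul_mul_assoc]
  have hxb : x * (q * a * q) = r • x := by
    calc x * (q * a * q) = q * c m * (q * q) * a * q := by rw [hx]; noncomm_ring
      _ = r • x := by
        rw [hqq, hblock _ _ (hcp m) hinv', (hac m (by omega)).2, mul_add, add_mul,
          hlow _ (by omega), add_zero, mul_smul_comm, smul_mul_assoc]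
  -- The rescaled positive elements `q a R(r + t) q` converge to `r x`, and `r > 0` can be divided
  -- out.
  have hxn : x ∈ orderContinuous A := by
    have hlim := tendsto_of_hasSum_zpow (c := fun j => q * (a * c j) * q) (m := m)
      (g := fun t => q * (a * resolvent a ((r + t : ℝ) : ℂ)) * q) (fun j hj => by
        simp only [(hac j (by omega)).1, mul_add, add_mul, mul_smul_comm, smul_mul_assoc,
          hlow j hj, hlow (j - 1) (by omega), smul_zero, add_zero]) (by
        filter_upwards [hpole.hasSum_real] with t ht
        refine (((ht.mul_left a).mul_left q).mul_right q).congr_fun fun j => ?_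
        rw [mul_smul_comm, mul_smul_comm, smul_mul_assoc])
    have hrx : r • x ∈ orderContinuous A := by
      have e : q * (a * c m) * q = r • x := by
        rw [(hac m (by omega)).1, mul_add, add_mul, hlow (m - 1) (by omega), add_zero,
          mul_smul_comm, smul_mul_assoc]
      simp only [e] at hlim
      refine hA.closed.mem_of_tendsto hlim ?_
      filter_upwards [self_mem_nhdsWithin] with t ht
      have ht0 : (0 : ℝ) < t := ht
      exact orderContinuous_smul (orderContinuous_mul_right (orderContinuous_mul_left
        (mul_resolvent_mem_orderContinuous hA.orderRegular hA.closed ha (by linarith)) hq) hq)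
        (zpow_nonneg ht0.le _)
    have := orderContinuous_smul hrx (inv_nonneg.2 hr.le)
    rwa [smul_smul, inv_mul_cancel₀ hr.ne', one_smul] at this
  have hbn : q * a * q ∈ orderContinuous A :=
    orderContinuous_mul_right (orderContinuous_mul_left ha hq) hq
  have hirr' : IrreducibleWrt (q * a * q) q := by
    refine hirr (le_antisymm ?_ ?_)
    · rw [hqdef]; exact spectralRadius_block_le hp hp' hinv hinv'
    · rw [← ofReal_specRadius]
      exact le_spectralRadius_of_mul_eq_smul hr.le hm hbx
  have hxx : x * x = q * c (m + m + 1) * q := by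
    calc x * x = q * c m * (q * q) * c m * q := by rw [hx]; noncomm_ring
      _ = _ := by
        rw [hqq, hblock _ _ (hcp m) (hcp' m), laurentCoeff_mul hpole.eq_zero
          (fun j => (hcoef j).1) (fun j => (hcoef j).2) (by omega) (by omega)]
  -- For `m < -1` the index `2m + 1` lies below `m`, so `x²` would vanish.
  have hmeq : m = -1 := by
    by_contra hne
    exact hirr'.mul_self_ne_zero hA hq hbn hxn hqx hxq hm hxb
      (by rw [hxx, hlow _ (by omega)])
  rw [← hmeq, ← hx]
  refine ⟨?_, hxn, q, hq, ?_, by rw [hqx, hxq], ?_⟩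
  · rw [hxx, hx, hmeq]; norm_num
  · intro h; rw [h, zero_mul] at hqx; exact hm hqx.symm
  · intro q₁ h₁ q₂ h₂ h₁0 h₁q h₂0 h₂q
    exact (mul_nonneg (mul_nonneg h₁.1 hxn.1) h₂.1).lt_of_ne'
      (hirr'.mul_mul_ne_zero hA hq hbn hxn hqx hxq hm hbx hxb h₁ h₂ h₁0.ne' h₁q h₂0.ne' h₂q)

end Main

/-- Without generators the span is the zero ideal, so a nonzero member already excludes the empty
case of `finiteRank`. -/
theorem mem_finiteRank_of_ne_zero {A : Type u} [Ring A] [PartialOrder A] {x : A} (hx : x ≠ 0)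
    (h : x ∈ TwoSidedIdeal.span (rankOneProjections A)) : x ∈ finiteRank A := by
  refine ⟨?_, h⟩
  by_contra! he
  refine hx ((TwoSidedIdeal.mem_bot A).1 (TwoSidedIdeal.span_le.2 ?_ h))
  rw [he]
  exact Set.empty_subset _

end OrderedBanachAlg

open OrderedBanachAlg in
theorem theorem23 {A : Type u} [NormedRing A] [NormedAlgebra ℂ A] [CompleteSpace A] [Nontrivial A]
    [PartialOrder A] [IsOrderedRing A] [PosSMulMono ℝ A] [OrderClosedTopology A]
    (hA : OrderedBanachAlg.AxiomA1 A)
    (a : A) (ha : a ∈ OrderedBanachAlg.orderContinuous A)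
    (hF : OrderedBanachAlg.HasFrobeniusNormalForm a)
    (k : ℕ) (c : ℤ → A)
    (hpole : OrderedBanachAlg.IsResolventPole a (OrderedBanachAlg.specRadius a : ℂ) k c) :
    c (-1) ∈ OrderedBanachAlg.finiteRank A := by
  obtain ⟨n, p, hp, hp0, hp1, hmono, hirr⟩ := hF
  set I := TwoSidedIdeal.span (rankOneProjections A)
  have hsub : ∀ x ∈ rankOneProjections A, x ∈ I := fun x hx => TwoSidedIdeal.subset_span hx
  have hcoef := hpole.coeff_rec
  -- If `c (-1)` vanished, the recursion would kill all lower coefficients, including `c (-k)`.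
  have hne : c (-1) ≠ 0 := by
    intro h0
    have hz : ∀ j : ℕ, c (-1 - j) = 0 := by
      intro j
      induction j with
      | zero => simpa using h0
      | succ j ih =>
        have := (hcoef (-1 - j)).1
        rw [ih, mul_zero, if_neg (by omega), add_zero] at this
        rw [← this]; congr 1; push_cast; ring
    have hk := hpole.one_le
    apply hpole.ne_zero
    rw [← hz (k - 1)]; congr 1; omega
  refine mem_finiteRank_of_ne_zero hne ?_
  have hr0 : 0 ≤ specRadius a := ENNReal.toReal_nonneg
  rcases hr0.eq_or_lt with hr | hr
  · have hnil := pow_eq_zero_of_isResolventPole_zero ha.1 hpole hr.symm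
    have hrad : spectralRadius ℂ a = 0 := by rw [← ofReal_specRadius, ← hr, ENNReal.ofReal_zero]
    have h1 : (1 : A) ∈ I := by
      refine one_mem_of_blocks_mem I (fun i => (hp i).1) hp0 hp1 hmono fun i => ?_
      set q := p i.succ * (1 - p i.castSucc) with hqdef
      have hq : q ∈ OI A := OI_mul_mem (hp _).1 (one_sub_mem_OI (hp _).1)
      by_cases hq0 : q = 0
      · rw [hq0]; exact I.zero_mem
      have hle := spectralRadius_block_le (hp i.castSucc).1 (hp i.succ).1 (hp i.castSucc).2
        (hp i.succ).2
      rw [← hqdef, hrad] at hle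
      -- Every block has spectral radius `0 = r(a)`, so the normal form makes all of them
      -- irreducible.
      have hb := hirr i q hqdef (by rw [hrad]; exact le_antisymm hle zero_le)
      have hpow : (q * a * q) ^ (k + 1) = 0 := by
        rw [hqdef, block_pow (hp _).1 (hp _).1 (hp _).2 (hp _).2, pow_succ, hnil]; simp
      have hb0 : q * a * q = 0 := hb.eq_zero_of_pow_eq_zero hA.orderRegular hA.disjunctive
        hA.dedekind hq (orderContinuous_mul_right (orderContinuous_mul_left ha hq) hq)
        (by rw [← mul_assoc q (q * a), ← mul_assoc q q, hq.2.2])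
        (by rw [mul_assoc, hq.2.2]) hpow
      rw [hb0] at hb
      exact hsub q (mem_rankOneProjections_of_irreducibleWrt_zero hq hq0 hb)
    have := I.mul_mem_left (c (-1)) 1 h1
    rwa [mul_one] at this
  · refine mem_of_blocks_mem I (fun i => (hp i).1) hp0 hp1 hmono ?_
      (fun i => hpole.isInvariant_coeff (hp i).1 (hp i).2 _) fun i => ?_
    · rw [laurentCoeff_mul hpole.eq_zero (fun j => (hcoef j).1) (fun j => (hcoef j).2)
        (by norm_num) (by norm_num)]
      norm_num
    · by_cases h0 : p i.succ * (1 - p i.castSucc) * c (-1) * (p i.succ * (1 - p i.castSucc)) = 0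
      · rw [h0]; exact I.zero_mem
      · exact hsub _ (block_residue_mem hA ha hpole hr (hp i.castSucc).1 (hp i.succ).1
          (hp i.castSucc).2 (hp i.succ).2 rfl (hirr i _ rfl) h0)
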